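/- Let $p$ be a prime, $x\in\mathbb{Z}_p$ a $p$-adic integer and $r\ge 0$ an integer. Let $\langle y\rangle_p\in\{0,\dots,p-1\}$ denote the least non-negative residue modulo $p$ of $y\in\mathbb{Z}_p$, and put $s:=(x+\langle -x\rangle_p)/p$. Write $(y)_n:=y(y+1)\cdots(y+n-1)$ for the Pochhammer symbol, $H_n^{(t)}:=\sum_{j=1}^n j^{-t}$, $B_n(\cdot)$ for the $n$-th Bernoulli polynomial, and $$S_n(\{t\}^r):=\sum_{1\le j_1\le\cdots\le j_r\le n}\frac{1}{j_1^{t}\cdots j_r^{t}}\qquad(S_n(\{t\}^0):=1).$$ For $a,b\in\mathbb{Q}_p$, $a\equiv b\pmod{p^m}$ means $a-b\in p^m\mathbb{Z}_p$. (i) If $p>r+3$, then $$\sum_{k=1}^{p-1}\frac{(x)_k}{(1)_k}\cdot\frac{S_k(\{1\}^r)}{k}\equiv -H^{(r+1)}_{\langle -x\rangle_p}-(-1)^r\,s\,p\,B_{p-r-2}(x)\pmod{p^2}.$$ (ii) If $p>2r+3$, then $$\sum_{k=1}^{p-1}\frac{(x)_k(1-x)_k}{(1)_k^2}\cdot\frac{S_k(\{2\}^r)}{k}\equiv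 -2H^{(2r+1)}_{\langle -x\rangle_p}-2(2r+1)\,s\,p\,H^{(2r+2)}_{\langle -x\rangle_p}+\frac{2s(1+3sr+2sr^2)}{2r+3}\,p^2B_{p-2r-3}(x)\pmod{p^3}.$$ -/

import Mathlib

/-- The generalized harmonic number `H_n^{(t)} = ∑_{j=1}^n 1 / j^t`. -/
def harmonicOrder (t n : ℕ) : ℚ :=
  ∑ j ∈ Finset.Icc 1 n, 1 / (j : ℚ) ^ t

open Classical in
/-- The non-strict multiple harmonic sum
`S_n(t_1, …, t_r) = ∑_{1 ≤ j_1 ≤ ⋯ ≤ j_r ≤ n} 1 / (j_1^{t_1} ⋯ j_r^{t_r})`;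
for `r = 0` it equals `1`. -/
noncomputable def multHarmonicSum {r : ℕ} (n : ℕ) (t : Fin r → ℕ) : ℚ :=
  ∑ j ∈ (Fintype.piFinset (fun _ : Fin r => Finset.Icc 1 n)).filter (fun j => Monotone j),
    1 / ∏ i, (j i : ℚ) ^ t i

/-- The Pochhammer symbol `(x)_n = x (x + 1) ⋯ (x + n - 1)`. -/
noncomputable def pochhammerSymbol {R : Type*} [CommRing R] (x : R) (n : ℕ) : R :=
  (ascPochhammer R n).eval x

/-- The congruence `a ≡ b (mod p^m)`, that is `a - b ∈ p^m ℤ_p`, for `p`-adic numbers. -/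
def PadicCongr (p : ℕ) [Fact p.Prime] (m : ℕ) (a b : ℚ_[p]) : Prop :=
  ∃ c : ℤ_[p], a - b = (p : ℚ_[p]) ^ m * (c : ℚ_[p])

section Algebra

variable {R : Type*} [CommRing R]

/-- The complete homogeneous sum `∑_{1 ≤ j_1 ≤ ⋯ ≤ j_r ≤ n} c j_1 ⋯ c j_r`. -/
def completeSum (c : ℕ → R) : ℕ → ℕ → R
  | 0, _ => 1
  | r + 1, n => ∑ k ∈ Finset.Icc 1 n, c k * completeSum c r k

/-- The power sum `∑_{j=1}^n c j ^ t`. -/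
def powerSum (c : ℕ → R) (t n : ℕ) : R := ∑ j ∈ Finset.Icc 1 n, c j ^ t

/-- The product `∏_{i<k} (x + i) c_{i+1}`, which is `(x)_k / (1)_k` when `c j = 1 / j`. -/
def risingQuot (c : ℕ → R) (x : R) (k : ℕ) : R := ∏ i ∈ Finset.range k, (x + i) * c (i + 1)

/-- The sum `∑_{k=1}^n (x)_k / (1)_k · S_k({1}^r) / k`, for inverses `c`. -/
def linearSum (c : ℕ → R) (r n : ℕ) (x : R) : R :=
  ∑ k ∈ Finset.Icc 1 n, risingQuot c x k * (c k * completeSum c r k)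

/-- The sum `∑_{k=1}^n (x)_k (1-x)_k / (1)_k^2 · S_k({2}^r) / k`, for inverses `c`. -/
def quadraticSum (c : ℕ → R) (r n : ℕ) (x : R) : R :=
  ∑ k ∈ Finset.Icc 1 n,
    risingQuot c x k * risingQuot c (1 - x) k * (c k * completeSum (fun j => c j ^ 2) r k)

@[simp] theorem completeSum_zero (c : ℕ → R) (n : ℕ) : completeSum c 0 n = 1 := rfl

theorem completeSum_succ (c : ℕ → R) (r n : ℕ) :
    completeSum c (r + 1) n = ∑ k ∈ Finset.Icc 1 n, c k * completeSum c r k := rfl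

@[simp] theorem completeSum_succ_zero (c : ℕ → R) (r : ℕ) : completeSum c (r + 1) 0 = 0 := by
  simp [completeSum_succ]

theorem completeSum_succ_succ (c : ℕ → R) (r n : ℕ) :
    completeSum c (r + 1) (n + 1) =
      completeSum c (r + 1) n + c (n + 1) * completeSum c r (n + 1) := by
  rw [completeSum_succ, Finset.sum_Icc_succ_top (by omega), ← completeSum_succ]

theorem powerSum_zero_right (c : ℕ → R) (t : ℕ) : powerSum c t 0 = 0 := by
  simp [powerSum]

theorem powerSum_succ (c : ℕ → R) (t n : ℕ) :
    powerSum c t (n + 1) = powerSum c t n + c (n + 1) ^ t := by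
  rw [powerSum, Finset.sum_Icc_succ_top (by omega), ← powerSum]

theorem completeSum_congr {c d : ℕ → R} (r n : ℕ) (h : ∀ j, 1 ≤ j → j ≤ n → c j = d j) :
    completeSum c r n = completeSum d r n := by
  induction r generalizing n with
  | zero => rfl
  | succ r ih =>
    rw [completeSum_succ, completeSum_succ]
    refine Finset.sum_congr rfl fun k hk => ?_
    rw [Finset.mem_Icc] at hk
    rw [h k hk.1 hk.2, ih k fun j h1 h2 => h j h1 (h2.trans hk.2)]

theorem map_completeSum {S : Type*} [CommRing S] (φ : R →+* S) (c : ℕ → R) (r n : ℕ) :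
    φ (completeSum c r n) = completeSum (fun j => φ (c j)) r n := by
  induction r generalizing n with
  | zero => simp
  | succ r ih => simp [completeSum_succ, ih]

theorem map_powerSum {S : Type*} [CommRing S] (φ : R →+* S) (c : ℕ → R) (t n : ℕ) :
    φ (powerSum c t n) = powerSum (fun j => φ (c j)) t n := by
  simp [powerSum]

theorem map_risingQuot {S : Type*} [CommRing S] (φ : R →+* S) (c : ℕ → R) (x : R) (k : ℕ) :
    φ (risingQuot c x k) = risingQuot (fun j => φ (c j)) (φ x) k := by
  simp [risingQuot]

theorem map_linearSum {S : Type*} [CommRing S] (φ : R →+* S) (c : ℕ → R) (r n : ℕ) (x : R) :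
    φ (linearSum c r n x) = linearSum (fun j => φ (c j)) r n (φ x) := by
  simp [linearSum, map_risingQuot, map_completeSum]

/-- Newton's identity for complete homogeneous sums. -/
theorem newton_completeSum (c : ℕ → R) (r n : ℕ) :
    ((r : R) + 1) * completeSum c (r + 1) n =
      ∑ ij ∈ Finset.HasAntidiagonal.antidiagonal r, completeSum c ij.1 n * powerSum c (ij.2 + 1) n := by
  have key : ∀ n, PowerSeries.derivative R (PowerSeries.mk fun r => completeSum c r n) =
      (PowerSeries.mk fun r => completeSum c r n) *
        PowerSeries.mk fun r => powerSum c (r + 1) n := by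
    intro n
    induction n with
    | zero =>
      ext r
      simp [PowerSeries.coeff_derivative, PowerSeries.coeff_mul, powerSum_zero_right]
    | succ n ih =>
      set a := c (n + 1)
      have hH : (PowerSeries.mk fun r => completeSum c r (n + 1)) *
          (1 - PowerSeries.C a * PowerSeries.X) = PowerSeries.mk fun r => completeSum c r n := by
        ext r
        rw [mul_sub, mul_one, ← mul_assoc, map_sub]
        cases r with
        | zero => simp
        | succ r =>
          rw [PowerSeries.coeff_succ_mul_X, PowerSeries.coeff_mul_C]
          simp only [PowerSeries.coeff_mk]
          rw [completeSum_succ_succ]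
          ring
      have hG : (PowerSeries.mk fun r => a ^ (r + 1)) *
          (1 - PowerSeries.C a * PowerSeries.X) = PowerSeries.C a := by
        ext r
        rw [mul_sub, mul_one, ← mul_assoc, map_sub]
        cases r with
        | zero => simp
        | succ r =>
          rw [PowerSeries.coeff_succ_mul_X, PowerSeries.coeff_mul_C]
          simp only [PowerSeries.coeff_mk]
          rw [PowerSeries.coeff_C]
          simp
          ring
      have hI : (PowerSeries.mk fun r => a ^ r) *
          (1 - PowerSeries.C a * PowerSeries.X) = 1 := by
        ext r
        rw [mul_sub, mul_one, ← mul_assoc, map_sub]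
        cases r with
        | zero => simp
        | succ r =>
          rw [PowerSeries.coeff_succ_mul_X, PowerSeries.coeff_mul_C]
          simp only [PowerSeries.coeff_mk]
          rw [PowerSeries.coeff_one]
          simp
          ring
      have hP : (PowerSeries.mk fun r => powerSum c (r + 1) (n + 1)) =
          (PowerSeries.mk fun r => powerSum c (r + 1) n) + PowerSeries.mk fun r => a ^ (r + 1) := by
        ext r
        simp [powerSum_succ, a]
      have hd := congrArg (PowerSeries.derivative R) hH
      rw [ih, Derivation.leibniz, map_sub, Derivation.leibniz] at hd
      simp only [smul_eq_mul, PowerSeries.derivative_C, PowerSeries.derivative_X,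
        Derivation.map_one_eq_zero, mul_zero, add_zero, mul_one, zero_sub] at hd
      rw [hP]
      generalize (PowerSeries.mk fun r => completeSum c r (n + 1)) = A at *
      generalize (PowerSeries.mk fun r => completeSum c r n) = B at *
      generalize (PowerSeries.mk fun r => powerSum c (r + 1) n) = P at *
      generalize (PowerSeries.mk fun r => a ^ (r + 1)) = G at *
      generalize (PowerSeries.mk fun r => a ^ r) = I at *
      linear_combination I * hd - I * P * hH - I * A * hG +
        (PowerSeries.derivative R A - A * (P + G)) * (-hI)
  have := congrArg (PowerSeries.coeff r) (key n)
  rw [PowerSeries.coeff_mul] at this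
  simp only [PowerSeries.coeff_derivative, PowerSeries.coeff_mk] at this
  rw [← this, mul_comm]

theorem risingQuot_zero (c : ℕ → R) (x : R) : risingQuot c x 0 = 1 := by simp [risingQuot]

theorem risingQuot_succ (c : ℕ → R) (x : R) (k : ℕ) :
    risingQuot c x (k + 1) = risingQuot c x k * ((x + k) * c (k + 1)) := by
  rw [risingQuot, Finset.prod_range_succ, ← risingQuot]

theorem risingQuot_succ' (c : ℕ → R) (x : R) (k : ℕ) :
    risingQuot c x (k + 1) = x * risingQuot c (x + 1) k * c (k + 1) := by
  induction k with
  | zero => simp [risingQuot]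
  | succ k ih =>
    rw [risingQuot_succ, ih, risingQuot_succ]
    push_cast
    ring

variable {c : ℕ → R} {n : ℕ}

theorem risingQuot_one (hc : ∀ j, 1 ≤ j → j ≤ n → (j : R) * c j = 1) :
    ∀ k ≤ n, risingQuot c 1 k = 1 := by
  intro k hk
  refine Finset.prod_eq_one fun i hi => ?_
  rw [Finset.mem_range] at hi
  have := hc (i + 1) (by omega) (by omega)
  push_cast at this
  rw [add_comm, this]

theorem sum_Icc_one {M : Type*} [AddCommMonoid M] (f : ℕ → M) (n : ℕ) :
    ∑ k ∈ Finset.Icc 1 n, f k = ∑ k ∈ Finset.range n, f (k + 1) := by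
  induction n with
  | zero => simp
  | succ n ih => rw [Finset.sum_Icc_succ_top (by omega), Finset.sum_range_succ, ih]

/-- The forward difference of `linearSum`. -/
def linearDiff (c : ℕ → R) (r n : ℕ) (x : R) : R :=
  ∑ k ∈ Finset.range n, risingQuot c (x + 1) k * (c (k + 1) * completeSum c r (k + 1))

theorem linearSum_add_one (hc : ∀ j, 1 ≤ j → j ≤ n → (j : R) * c j = 1) (r : ℕ) (x : R) :
    linearSum c r n (x + 1) = linearSum c r n x + linearDiff c r n x := by
  rw [linearSum, linearSum, linearDiff, sum_Icc_one, sum_Icc_one, ← Finset.sum_add_distrib]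
  refine Finset.sum_congr rfl fun k hk => ?_
  rw [Finset.mem_range] at hk
  have h := hc (k + 1) (by omega) (by omega)
  push_cast at h
  rw [risingQuot_succ, risingQuot_succ']
  linear_combination (risingQuot c (x + 1) k * (c (k + 1) * completeSum c r (k + 1))) * h

theorem mul_linearDiff_succ (hc : ∀ j, 1 ≤ j → j ≤ n → (j : R) * c j = 1) (r : ℕ) (x : R) :
    x * linearDiff c (r + 1) n x =
      risingQuot c (x + 1) n * completeSum c (r + 1) n - linearDiff c r n x := by
  induction n with
  | zero => simp [linearDiff]
  | succ n ih =>
    have h := hc (n + 1) (by omega) (by omega)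
    push_cast at h
    have ih := ih fun j h1 h2 => hc j h1 (by omega)
    rw [linearDiff] at ih ⊢
    rw [linearDiff] at ih ⊢
    rw [Finset.sum_range_succ, Finset.sum_range_succ, mul_add, ih, risingQuot_succ,
      completeSum_succ_succ]
    linear_combination (-risingQuot c (x + 1) n *
      (completeSum c (r + 1) n + c (n + 1) * completeSum c r (n + 1))) * h

theorem mul_linearDiff_zero (hc : ∀ j, 1 ≤ j → j ≤ n → (j : R) * c j = 1) (x : R) :
    x * linearDiff c 0 n x = risingQuot c (x + 1) n - 1 := by
  induction n with
  | zero => simp [linearDiff, risingQuot_zero]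
  | succ n ih =>
    have h := hc (n + 1) (by omega) (by omega)
    push_cast at h
    have ih := ih fun j h1 h2 => hc j h1 (by omega)
    rw [linearDiff] at ih ⊢
    rw [Finset.sum_range_succ, mul_add, ih, risingQuot_succ, completeSum_zero]
    linear_combination (-risingQuot c (x + 1) n) * h

/-- The product `∏_{i=1}^k (i + x) (i - x) c_i^2`. -/
def symmetricQuot (c : ℕ → R) (x : R) (k : ℕ) : R :=
  risingQuot c (1 + x) k * risingQuot c (1 - x) k

theorem symmetricQuot_zero (c : ℕ → R) (x : R) : symmetricQuot c x 0 = 1 := by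
  simp [symmetricQuot, risingQuot_zero]

theorem symmetricQuot_succ {k : ℕ} (h : ((k : R) + 1) * c (k + 1) = 1) (x : R) :
    symmetricQuot c x (k + 1) = symmetricQuot c x k * (1 - x ^ 2 * c (k + 1) ^ 2) := by
  simp only [symmetricQuot, risingQuot_succ]
  linear_combination (risingQuot c (1 + x) k * risingQuot c (1 - x) k *
    (((k : R) + 1) * c (k + 1) + 1)) * h

/-- The forward difference of `quadraticSum`, divided by `-2 x`. -/
def quadraticDiff (c : ℕ → R) (r n : ℕ) (x : R) : R :=
  ∑ k ∈ Finset.range n,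
    symmetricQuot c x k * (c (k + 1) ^ 2 * completeSum (fun j => c j ^ 2) r (k + 1))

theorem risingQuot_mul_risingQuot_succ (c : ℕ → R) (x : R) (k : ℕ) :
    risingQuot c x (k + 1) * risingQuot c (1 - x) (k + 1) =
      symmetricQuot c x k * (x * c (k + 1)) * ((k + 1 - x) * c (k + 1)) := by
  rw [risingQuot_succ', risingQuot_succ, symmetricQuot, add_comm x 1]
  ring

theorem quadraticSum_add_one (hc : ∀ j, 1 ≤ j → j ≤ n → (j : R) * c j = 1) (r : ℕ) (x : R) :
    quadraticSum c r n (x + 1) = quadraticSum c r n x - 2 * x * quadraticDiff c r n x := by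
  rw [quadraticSum, quadraticSum, quadraticDiff, sum_Icc_one, sum_Icc_one, Finset.mul_sum,
    ← Finset.sum_sub_distrib]
  refine Finset.sum_congr rfl fun k hk => ?_
  rw [Finset.mem_range] at hk
  have h := hc (k + 1) (by omega) (by omega)
  push_cast at h
  rw [risingQuot_mul_risingQuot_succ c x, mul_comm (risingQuot c (x + 1) (k + 1))]
  have e : risingQuot c (1 - (x + 1)) (k + 1) * risingQuot c (x + 1) (k + 1) =
      symmetricQuot c x k * (-x * c (k + 1)) * ((k + 1 + x) * c (k + 1)) := by
    have := risingQuot_mul_risingQuot_succ c (-x) k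
    rw [show 1 - (x + 1) = -x by ring, add_comm x 1, ← sub_neg_eq_add 1 x, this]
    simp only [symmetricQuot, sub_neg_eq_add, ← sub_eq_add_neg]
    ring
  rw [e]
  linear_combination (-2 * symmetricQuot c x k * x * c (k + 1) *
    (c (k + 1) * completeSum (fun j => c j ^ 2) r (k + 1))) * h

theorem sq_mul_quadraticDiff_succ (hc : ∀ j, 1 ≤ j → j ≤ n → (j : R) * c j = 1) (r : ℕ) (x : R) :
    x ^ 2 * quadraticDiff c (r + 1) n x =
      quadraticDiff c r n x - symmetricQuot c x n * completeSum (fun j => c j ^ 2) (r + 1) n := by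
  induction n with
  | zero => simp [quadraticDiff]
  | succ n ih =>
    have h := hc (n + 1) (by omega) (by omega)
    push_cast at h
    have ih := ih fun j h1 h2 => hc j h1 (by omega)
    rw [quadraticDiff] at ih ⊢
    rw [quadraticDiff] at ih ⊢
    rw [Finset.sum_range_succ, Finset.sum_range_succ, mul_add, ih, symmetricQuot_succ h,
      completeSum_succ_succ]
    ring

theorem sq_mul_quadraticDiff_zero (hc : ∀ j, 1 ≤ j → j ≤ n → (j : R) * c j = 1) (x : R) :
    x ^ 2 * quadraticDiff c 0 n x = 1 - symmetricQuot c x n := by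
  induction n with
  | zero => simp [quadraticDiff, symmetricQuot_zero]
  | succ n ih =>
    have h := hc (n + 1) (by omega) (by omega)
    push_cast at h
    have ih := ih fun j h1 h2 => hc j h1 (by omega)
    rw [quadraticDiff] at ih ⊢
    rw [Finset.sum_range_succ, mul_add, ih, symmetricQuot_succ h, completeSum_zero]
    ring

end Algebra

section PadicCongruences

variable {p : ℕ} [hp : Fact p.Prime]

/-- The inverse of a natural number in `ℤ_[p]`, with junk value `0` at multiples of `p`. -/
noncomputable def padicInv (p : ℕ) [Fact p.Prime] (j : ℕ) : ℤ_[p] := Ring.inverse (j : ℤ_[p])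

theorem isUnit_natCast_padicInt {j : ℕ} (h1 : 1 ≤ j) (h2 : j < p) : IsUnit (j : ℤ_[p]) := by
  rw [PadicInt.isUnit_iff, PadicInt.norm_natCast_eq_one_iff]
  exact Nat.coprime_of_lt_prime (by omega) h2 hp.out

theorem mul_padicInv {j : ℕ} (h1 : 1 ≤ j) (h2 : j < p) : (j : ℤ_[p]) * padicInv p j = 1 :=
  Ring.mul_inverse_cancel _ (isUnit_natCast_padicInt h1 h2)

theorem mul_padicInv_of_le (j : ℕ) (h1 : 1 ≤ j) (h2 : j ≤ p - 1) :
    (j : ℤ_[p]) * padicInv p j = 1 :=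
  mul_padicInv h1 (by have := hp.out.pos; omega)

theorem prime_dvd_iff_toZMod (x : ℤ_[p]) : (p : ℤ_[p]) ∣ x ↔ PadicInt.toZMod x = 0 := by
  rw [← RingHom.mem_ker, PadicInt.ker_toZMod, PadicInt.maximalIdeal_eq_span_p,
    Ideal.mem_span_singleton]

theorem dvd_of_natCast_mul {m k : ℕ} {y : ℤ_[p]} (h1 : 1 ≤ k) (h2 : k < p)
    (h : (p : ℤ_[p]) ^ m ∣ k * y) : (p : ℤ_[p]) ^ m ∣ y :=
  (isUnit_natCast_padicInt h1 h2).dvd_mul_left.1 h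

theorem toZMod_padicInv {j : ℕ} (h1 : 1 ≤ j) (h2 : j < p) :
    PadicInt.toZMod (padicInv p j) = (j : ZMod p)⁻¹ := by
  have h := congrArg (PadicInt.toZMod (p := p)) (mul_padicInv h1 h2)
  rw [map_mul, map_natCast, map_one] at h
  exact eq_inv_of_mul_eq_one_right h

theorem natCast_zmod_ne_zero {j : ℕ} (h1 : 1 ≤ j) (h2 : j < p) : (j : ZMod p) ≠ 0 := by
  rw [Ne, ZMod.natCast_eq_zero_iff]
  exact Nat.not_dvd_of_pos_of_lt h1 h2

@[to_additive]
theorem prod_range_natCast_zmod {M : Type*} [CommMonoid M] (g : ZMod p → M) :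
    ∏ i ∈ Finset.range p, g (i : ZMod p) = ∏ y : ZMod p, g y := by
  refine Finset.prod_nbij' (fun i => (i : ZMod p)) ZMod.val ?_ ?_ ?_ ?_ ?_
  · simp
  · intro y _
    simpa using ZMod.val_lt y
  · intro i hi
    exact ZMod.val_cast_of_lt (Finset.mem_range.1 hi)
  · intro y _
    simp
  · intro i _
    rfl

theorem sum_Icc_natCast_zmod (g : ZMod p → ZMod p) (h0 : g 0 = 0) :
    ∑ j ∈ Finset.Icc 1 (p - 1), g (j : ZMod p) = ∑ y : ZMod p, g y := by
  rw [← sum_range_natCast_zmod, sum_Icc_one]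
  obtain ⟨n, hn⟩ : ∃ n, p = n + 1 := ⟨p - 1, by have := hp.out.pos; omega⟩
  have : Finset.range p = Finset.range (n + 1) := by rw [← hn]
  rw [this, Finset.sum_range_succ', show p - 1 = n by omega]
  simp [h0]

theorem powerSum_toZMod (t n : ℕ) (hn : n < p) :
    PadicInt.toZMod (powerSum (padicInv p) t n) =
      ∑ j ∈ Finset.Icc 1 n, ((j : ZMod p)⁻¹) ^ t := by
  rw [map_powerSum, powerSum]
  refine Finset.sum_congr rfl fun j hj => ?_
  rw [Finset.mem_Icc] at hj
  rw [toZMod_padicInv hj.1 (by omega)]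

theorem dvd_powerSum {t : ℕ} (h1 : 1 ≤ t) (h2 : t < p - 1) :
    (p : ℤ_[p]) ∣ powerSum (padicInv p) t (p - 1) := by
  rw [prime_dvd_iff_toZMod, powerSum_toZMod _ _ (by have := hp.out.pos; omega),
    sum_Icc_natCast_zmod (fun y => (y⁻¹) ^ t) (by simp; omega)]
  rw [(inv_involutive (G := ZMod p)).bijective.sum_comp (fun y => y ^ t)]
  exact FiniteField.sum_pow_lt_card_sub_one _ _ (by rwa [ZMod.card])

theorem powerSum_pow (c : ℕ → ℤ_[p]) (u t n : ℕ) :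
    powerSum (fun j => c j ^ u) t n = powerSum c (u * t) n := by
  simp [powerSum, pow_mul]

theorem dvd_completeSum {u : ℕ} (hu : 1 ≤ u) {r : ℕ} (h1 : 1 ≤ r) (h2 : u * r < p - 1) :
    (p : ℤ_[p]) ∣ completeSum (fun j => padicInv p j ^ u) r (p - 1) := by
  obtain ⟨r, rfl⟩ : ∃ k, r = k + 1 := ⟨r - 1, by omega⟩
  have hr : r + 1 ≤ u * (r + 1) := Nat.le_mul_of_pos_left _ hu
  have h : (p : ℤ_[p]) ^ 1 ∣ ((r + 1 : ℕ) : ℤ_[p]) *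
      completeSum (fun j => padicInv p j ^ u) (r + 1) (p - 1) := by
    push_cast
    rw [newton_completeSum, pow_one]
    refine Finset.dvd_sum fun ij hij => Dvd.dvd.mul_left ?_ _
    rw [Finset.HasAntidiagonal.mem_antidiagonal] at hij
    rw [powerSum_pow]
    refine dvd_powerSum (Nat.mul_pos hu (by omega)) (lt_of_le_of_lt ?_ h2)
    exact Nat.mul_le_mul_left _ (by omega)
  simpa using dvd_of_natCast_mul (by omega) (by omega) h

theorem sq_dvd_completeSum_sub_powerSum {u : ℕ} (hu : 1 ≤ u) {r : ℕ} (h1 : 1 ≤ r)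
    (h2 : u * r < p - 1) :
    (p : ℤ_[p]) ^ 2 ∣ r * completeSum (fun j => padicInv p j ^ u) r (p - 1) -
      powerSum (padicInv p) (u * r) (p - 1) := by
  obtain ⟨r, rfl⟩ : ∃ k, r = k + 1 := ⟨r - 1, by omega⟩
  have := newton_completeSum (fun j => padicInv p j ^ u) r (p - 1)
  push_cast
  rw [this, Finset.Nat.sum_antidiagonal_eq_sum_range_succ_mk, Finset.sum_range_succ']
  simp only [completeSum_zero, powerSum_pow, Nat.sub_zero, one_mul]
  rw [add_sub_cancel_right, pow_two]
  refine Finset.dvd_sum fun k hk => ?_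
  rw [Finset.mem_range] at hk
  refine mul_dvd_mul (dvd_completeSum hu (by omega) (lt_of_le_of_lt ?_ h2))
    (dvd_powerSum (Nat.mul_pos hu (by omega)) (lt_of_le_of_lt ?_ h2)) <;>
  exact Nat.mul_le_mul_left _ (by omega)

theorem prod_range_erase_sub (j : ℕ) (hj : j < p) :
    ∏ i ∈ (Finset.range p).erase j, ((i : ZMod p) - j) = -1 := by
  classical
  have key : ∀ j < p, ∏ i ∈ (Finset.range p).erase j, ((i : ZMod p) - j) =
      ∏ y : ZMod p, if y = 0 then 1 else y := by
    intro j hj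
    rw [← (Equiv.subRight (j : ZMod p)).prod_comp, ← prod_range_natCast_zmod,
      ← Finset.mul_prod_erase _ _ (Finset.mem_range.2 hj)]
    simp only [Equiv.subRight_apply, sub_self, if_true, one_mul]
    refine Finset.prod_congr rfl fun i hi => ?_
    rw [Finset.mem_erase, Finset.mem_range] at hi
    rw [if_neg]
    rw [sub_eq_zero, ZMod.natCast_eq_natCast_iff']
    rw [Nat.mod_eq_of_lt hi.2, Nat.mod_eq_of_lt hj]
    exact hi.1
  rw [key j hj, ← key 0 hp.out.pos]
  have := ZMod.wilsons_lemma p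
  rw [← this, ← Finset.prod_Ico_id_eq_factorial, Nat.cast_prod]
  refine Finset.prod_congr ?_ (by simp)
  have := hp.out.pos
  ext i
  simp
  omega

theorem prod_padicInv :
    ∃ e : ℤ_[p], ∏ i ∈ Finset.range (p - 1), padicInv p (i + 1) = -1 + p * e := by
  suffices h : (p : ℤ_[p]) ∣ ∏ i ∈ Finset.range (p - 1), padicInv p (i + 1) + 1 by
    obtain ⟨e, he⟩ := h
    exact ⟨e, by linear_combination he⟩
  have h1 : (∏ i ∈ Finset.range (p - 1), ((i + 1 : ℕ) : ℤ_[p])) *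
      ∏ i ∈ Finset.range (p - 1), padicInv p (i + 1) = 1 := by
    rw [← Finset.prod_mul_distrib]
    refine Finset.prod_eq_one fun i hi => mul_padicInv (by omega) ?_
    rw [Finset.mem_range] at hi
    omega
  rw [← Nat.cast_prod, Finset.prod_range_add_one_eq_factorial] at h1
  have h2 := congrArg (PadicInt.toZMod (p := p)) h1
  rw [map_mul, map_natCast, ZMod.wilsons_lemma, map_one] at h2
  rw [prime_dvd_iff_toZMod, map_add, map_one]
  linear_combination -h2

theorem padicInv_reflect {j : ℕ} (h1 : 1 ≤ j) (h2 : j < p) :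
    padicInv p (p - j) = -padicInv p j + p * (padicInv p j * padicInv p (p - j)) := by
  have e1 := mul_padicInv h1 h2
  have e2 := mul_padicInv (p := p) (j := p - j) (by omega) (by omega)
  rw [Nat.cast_sub h2.le] at e2
  linear_combination (-padicInv p j) * e2 + (-padicInv p (p - j)) * e1

theorem risingQuot_mul_sub {j : ℕ} (h1 : 1 ≤ j) (h2 : j < p) (s : ℤ_[p]) :
    ∃ e, risingQuot (padicInv p) (s * p - j + 1) (p - 1) =
      -(s * p * padicInv p j) + p ^ 2 * e := by
  set z : ℤ_[p] := s * p - j with hz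
  set T := risingQuot (padicInv p) (z + 1) (p - 1) with hT
  obtain ⟨e₁, he₁⟩ := prod_padicInv (p := p)
  have hQ : (p : ℤ_[p]) ∣ ∏ i ∈ (Finset.range p).erase j, (z + i) + 1 := by
    rw [prime_dvd_iff_toZMod, map_add, map_prod, map_one]
    have := prod_range_erase_sub j h2
    rw [← eq_neg_iff_add_eq_zero, ← this]
    refine Finset.prod_congr rfl fun i _ => ?_
    simp [hz]
    ring
  obtain ⟨e₂, he₂⟩ := hQ
  have hzT : z * T = s * p * (-1 + p * e₂) * (-1 + p * e₁) := by
    have hpp : (p - 1) + 1 = p := by omega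
    have hprod : z * ∏ i ∈ Finset.range (p - 1), (z + 1 + (i : ℤ_[p])) =
        ∏ i ∈ Finset.range p, (z + (i : ℤ_[p])) := by
      have hr : Finset.range p = Finset.range (p - 1 + 1) := by rw [hpp]
      rw [hr, Finset.prod_range_succ', mul_comm]
      simp [add_comm, add_left_comm]
    rw [hT, risingQuot, Finset.prod_mul_distrib, he₁, ← mul_assoc, hprod,
      ← Finset.mul_prod_erase _ _ (Finset.mem_range.2 h2)]
    rw [hz] at he₂ ⊢
    linear_combination (s * p * (-1 + p * e₁)) * he₂
  have hc := mul_padicInv h1 h2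
  set c := padicInv p j
  have hT1 : T = c * s * p * (T - (-1 + p * e₂) * (-1 + p * e₁)) := by
    rw [hz] at hzT
    linear_combination (-c) * hzT - T * hc
  set u := c * s * (T - (-1 + p * e₂) * (-1 + p * e₁))
  refine ⟨c * s * (u + e₁ + e₂ - p * e₁ * e₂), ?_⟩
  linear_combination (1 + c * s * p) * hT1

theorem symmetricQuot_mul_sub {j : ℕ} (h1 : 1 ≤ j) (h2 : j < p) (s : ℤ_[p]) :
    ∃ e, symmetricQuot (padicInv p) (s * p - j) (p - 1) =
      -(s * (1 - s) * p ^ 2 * padicInv p j ^ 2) + p ^ 3 * e := by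
  obtain ⟨e₁, he₁⟩ := risingQuot_mul_sub h1 h2 s
  obtain ⟨e₂, he₂⟩ := risingQuot_mul_sub (p := p) (j := p - j) (by omega) (by omega) (1 - s)
  have h : (1 - (s * p - j) : ℤ_[p]) = (1 - s) * p - (p - j : ℕ) + 1 := by
    rw [Nat.cast_sub h2.le]
    ring
  have h3 := padicInv_reflect h1 h2
  rw [symmetricQuot, add_comm 1, he₁, h, he₂]
  generalize padicInv p (p - j) = d at *
  generalize padicInv p j = c at *
  refine ⟨s * (1 - s) * c * (c * d) - s * c * e₂ - e₁ * (1 - s) * d + p * e₁ * e₂, ?_⟩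
  linear_combination (s * p * c * (1 - s) * p) * h3

theorem linearDiff_congr {j r : ℕ} (h1 : 1 ≤ j) (h2 : j < p) (hr : r < p - 1) (s : ℤ_[p]) :
    ∃ e, linearDiff (padicInv p) r (p - 1) (s * p - j) =
      padicInv p j ^ (r + 1) * (1 + (r + 2) * s * p * padicInv p j) + p ^ 2 * e := by
  obtain ⟨t, ht⟩ := risingQuot_mul_sub h1 h2 s
  have hc := mul_padicInv h1 h2
  set c := padicInv p j with hcdef
  have inv : ∀ D E : ℤ_[p], (s * p - j) * D = -E →
      D = c * (1 + s * p * c) * E + p ^ 2 * (s ^ 2 * c ^ 2 * D) := by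
    intro D E h
    linear_combination (-c * (1 + s * p * c)) * h - D * (1 + s * p * c) * hc
  induction r with
  | zero =>
    have h := mul_linearDiff_zero (mul_padicInv_of_le (p := p)) (s * p - j)
    have h := inv _ (1 + s * p * c - p ^ 2 * t) (by rw [h, ht]; ring)
    generalize linearDiff (padicInv p) 0 (p - 1) (s * p - j) = D at h ⊢
    refine ⟨c * (s * c) ^ 2 - c * (1 + s * p * c) * t + s ^ 2 * c ^ 2 * D, ?_⟩
    push_cast
    linear_combination h
  | succ r ih =>
    obtain ⟨e, he⟩ := ih (by omega)
    obtain ⟨f, hf⟩ := dvd_completeSum (p := p) le_rfl (r := r + 1) (by omega) (by omega)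
    simp only [pow_one] at hf
    have h := mul_linearDiff_succ (mul_padicInv_of_le (p := p)) r (s * p - j)
    rw [ht, hf, he] at h
    have h := inv _ (c ^ (r + 1) * (1 + (r + 2) * s * p * c) + p ^ 2 * e
      - p ^ 2 * ((-(s * c) + p * t) * f)) (by rw [h]; ring)
    generalize linearDiff (padicInv p) (r + 1) (p - 1) (s * p - j) = D at h ⊢
    refine ⟨c * s * c * c ^ (r + 1) * (r + 2) * s * c +
      c * (1 + s * p * c) * (e - (-(s * c) + p * t) * f) + s ^ 2 * c ^ 2 * D, ?_⟩
    push_cast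
    linear_combination h

theorem quadraticDiff_congr {j r : ℕ} (h1 : 1 ≤ j) (h2 : j < p) (hr : 2 * r < p - 1)
    (s : ℤ_[p]) :
    ∃ e, quadraticDiff (padicInv p) r (p - 1) (s * p - j) =
      padicInv p j ^ (2 * r + 2) * (1 + (2 * r + 2) * s * p * padicInv p j +
        ((r + 1) * (2 * r + 3) * s ^ 2 + s * (1 - s)) * p ^ 2 * padicInv p j ^ 2) + p ^ 3 * e := by
  obtain ⟨t, ht⟩ := symmetricQuot_mul_sub h1 h2 s
  have hc := mul_padicInv h1 h2
  set c := padicInv p j with hcdef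
  set I := c ^ 2 * (1 + 2 * s * p * c + 3 * s ^ 2 * p ^ 2 * c ^ 2) with hI
  have inv : ∀ D E : ℤ_[p], (s * p - j) ^ 2 * D = E →
      D = I * E + p ^ 3 * (s ^ 3 * c ^ 3 * (4 - 3 * s * p * c) * D) := by
    intro D E h
    have hI2 : I * (s * p - j) ^ 2 = 1 - s ^ 3 * p ^ 3 * c ^ 3 * (4 - 3 * s * p * c) := by
      have h3 : c * (s * p - j) = s * p * c - 1 := by linear_combination -hc
      have h4 : I * (s * p - j) ^ 2 = (1 + 2 * s * p * c + 3 * s ^ 2 * p ^ 2 * c ^ 2) *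
          (c * (s * p - j)) ^ 2 := by rw [hI]; ring
      rw [h4, h3]
      ring
    linear_combination I * h - D * hI2
  induction r with
  | zero =>
    have h := sq_mul_quadraticDiff_zero (mul_padicInv_of_le (p := p)) (s * p - j)
    rw [ht] at h
    have h := inv _ _ h
    generalize quadraticDiff (padicInv p) 0 (p - 1) (s * p - j) = D at h ⊢
    refine ⟨c ^ 2 * (2 * s * c + 3 * s ^ 2 * p * c ^ 2) * s * (1 - s) * c ^ 2 - I * t +
      s ^ 3 * c ^ 3 * (4 - 3 * s * p * c) * D, ?_⟩
    push_cast
    rw [hI] at h ⊢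
    linear_combination h
  | succ r ih =>
    obtain ⟨e, he⟩ := ih (by omega)
    obtain ⟨f, hf⟩ := dvd_completeSum (p := p) (u := 2) (by omega) (r := r + 1) (by omega)
      (by omega)
    have h := sq_mul_quadraticDiff_succ (mul_padicInv_of_le (p := p)) r (s * p - j)
    rw [ht, hf, he] at h
    have h := inv _ _ h
    generalize quadraticDiff (padicInv p) (r + 1) (p - 1) (s * p - j) = D at h ⊢
    refine ⟨c ^ (2 * r + 4) * ((2 * r + 2) * s * c * (3 * s ^ 2 * c ^ 2) +
      (2 * s * c + 3 * s ^ 2 * p * c ^ 2) * 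
        ((r + 1) * (2 * r + 3) * s ^ 2 + s * (1 - s)) * c ^ 2) +
      I * (e - (-(s * (1 - s) * c ^ 2) + p * t) * f) +
      s ^ 3 * c ^ 3 * (4 - 3 * s * p * c) * D, ?_⟩
    push_cast
    rw [hI] at h ⊢
    linear_combination h

end PadicCongruences

section PadicSums

variable {p : ℕ} [hp : Fact p.Prime]

/-- The sum `∑_{k=1}^n c_k^t · S_k`, where `S_k` is the complete homogeneous sum of depth `r`
with weights `d`. -/
def weightedSum {R : Type*} [CommRing R] (c d : ℕ → R) (t r n : ℕ) : R :=
  ∑ k ∈ Finset.Icc 1 n, c k ^ t * completeSum d r k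

theorem prime_dvd_risingQuot_sub_one (s : ℤ_[p]) {k : ℕ} (hk : k ≤ p - 1) :
    (p : ℤ_[p]) ∣ risingQuot (padicInv p) (s * p + 1) k - 1 := by
  suffices h : (p : ℤ_[p]) ∣ risingQuot (padicInv p) (s * p + 1) k - risingQuot (padicInv p) 1 k by
    rwa [risingQuot_one (mul_padicInv_of_le (p := p)) k hk] at h
  rw [prime_dvd_iff_toZMod, map_sub, map_risingQuot, map_risingQuot]
  simp

theorem sq_dvd_symmetricQuot_sub_one (s : ℤ_[p]) {k : ℕ} (hk : k ≤ p - 1) :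
    (p : ℤ_[p]) ^ 2 ∣ symmetricQuot (padicInv p) (s * p) k - 1 := by
  induction k with
  | zero => simp [symmetricQuot_zero]
  | succ k ih =>
    obtain ⟨e, he⟩ := ih (by omega)
    have h := mul_padicInv_of_le (p := p) (k + 1) (by omega) hk
    push_cast at h
    rw [symmetricQuot_succ h]
    exact ⟨e * (1 - (s * p) ^ 2 * padicInv p (k + 1) ^ 2) - s ^ 2 * padicInv p (k + 1) ^ 2, by
      linear_combination (1 - (s * p) ^ 2 * padicInv p (k + 1) ^ 2) * he⟩

theorem linearSum_prime_mul (r : ℕ) (s : ℤ_[p]) :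
    (p : ℤ_[p]) ^ 2 ∣ linearSum (padicInv p) r (p - 1) (s * p) -
      s * p * weightedSum (padicInv p) (padicInv p) 2 r (p - 1) := by
  rw [linearSum, weightedSum, sum_Icc_one, sum_Icc_one, Finset.mul_sum, ← Finset.sum_sub_distrib]
  refine Finset.dvd_sum fun k hk => ?_
  rw [Finset.mem_range] at hk
  obtain ⟨e, he⟩ := prime_dvd_risingQuot_sub_one s hk.le
  rw [risingQuot_succ']
  exact ⟨s * e * padicInv p (k + 1) ^ 2 * completeSum (padicInv p) r (k + 1), by
    linear_combination (s * p * padicInv p (k + 1) ^ 2 *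
      completeSum (padicInv p) r (k + 1)) * he⟩

theorem quadraticSum_prime_mul (r : ℕ) (s : ℤ_[p]) :
    (p : ℤ_[p]) ^ 3 ∣ quadraticSum (padicInv p) r (p - 1) (s * p) -
      (s * p * completeSum (fun j => padicInv p j ^ 2) (r + 1) (p - 1) -
        s ^ 2 * p ^ 2 * weightedSum (padicInv p) (fun j => padicInv p j ^ 2) 3 r (p - 1)) := by
  rw [quadraticSum, weightedSum, completeSum_succ, sum_Icc_one, sum_Icc_one, sum_Icc_one,
    Finset.mul_sum, Finset.mul_sum, ← Finset.sum_sub_distrib, ← Finset.sum_sub_distrib]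
  refine Finset.dvd_sum fun k hk => ?_
  rw [Finset.mem_range] at hk
  obtain ⟨e, he⟩ := sq_dvd_symmetricQuot_sub_one s hk.le
  have h := mul_padicInv_of_le (p := p) (k + 1) (by omega) (by omega)
  push_cast at h
  rw [risingQuot_mul_risingQuot_succ]
  generalize symmetricQuot (padicInv p) (s * p) k = W at *
  generalize completeSum (fun j => padicInv p j ^ 2) r (k + 1) = S
  generalize padicInv p (k + 1) = c at *
  exact ⟨s * e * c ^ 2 * S * (1 - s * p * c), by
    linear_combination (s * p * c ^ 2 * S * (1 - s * p * c)) * he + (W * s * p * c ^ 2 * S) * h⟩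

/-- The expansion of `linearSum` modulo `p ^ 2`. -/
theorem linearSum_congr {r a : ℕ} (hr : r < p - 1) (ha : a < p) (s : ℤ_[p]) :
    (p : ℤ_[p]) ^ 2 ∣ linearSum (padicInv p) r (p - 1) (s * p - a) -
      (s * p * weightedSum (padicInv p) (padicInv p) 2 r (p - 1) -
        powerSum (padicInv p) (r + 1) a - (r + 2) * s * p * powerSum (padicInv p) (r + 2) a) := by
  induction a with
  | zero => simpa [powerSum_zero_right] using linearSum_prime_mul r s
  | succ a ih =>
    obtain ⟨e, he⟩ := ih (by omega)
    obtain ⟨t, ht⟩ := linearDiff_congr (j := a + 1) (by omega) ha hr s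
    have h := linearSum_add_one (mul_padicInv_of_le (p := p)) r (s * p - (a + 1 : ℕ))
    rw [show (s * p - (a + 1 : ℕ) + 1 : ℤ_[p]) = s * p - a by push_cast; ring, ht] at h
    rw [powerSum_succ, powerSum_succ]
    exact ⟨e - t, by linear_combination he - h⟩

/-- The expansion of `quadraticSum` modulo `p ^ 3`. -/
theorem quadraticSum_congr {r a : ℕ} (hr : 2 * r < p - 1) (ha : a < p) (s : ℤ_[p]) :
    (p : ℤ_[p]) ^ 3 ∣ quadraticSum (padicInv p) r (p - 1) (s * p - a) -
      (s * p * completeSum (fun j => padicInv p j ^ 2) (r + 1) (p - 1) -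
        s ^ 2 * p ^ 2 * weightedSum (padicInv p) (fun j => padicInv p j ^ 2) 3 r (p - 1) -
        2 * powerSum (padicInv p) (2 * r + 1) a -
        2 * (2 * r + 1) * s * p * powerSum (padicInv p) (2 * r + 2) a -
        2 * s * (1 + 3 * s * r + 2 * s * r ^ 2) * p ^ 2 *
          powerSum (padicInv p) (2 * r + 3) a) := by
  induction a with
  | zero => simpa [powerSum_zero_right] using quadraticSum_prime_mul r s
  | succ a ih =>
    obtain ⟨e, he⟩ := ih (by omega)
    obtain ⟨t, ht⟩ := quadraticDiff_congr (j := a + 1) (by omega) ha hr s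
    have h := quadraticSum_add_one (mul_padicInv_of_le (p := p)) r (s * p - (a + 1 : ℕ))
    have hc := mul_padicInv (p := p) (j := a + 1) (by omega) ha
    rw [show (s * p - (a + 1 : ℕ) + 1 : ℤ_[p]) = s * p - a by push_cast; ring, ht] at h
    rw [powerSum_succ, powerSum_succ, powerSum_succ]
    push_cast at h hc ⊢
    generalize padicInv p (a + 1) = c at *
    refine ⟨e + 2 * (s * p - (a + 1)) * t +
      2 * s * c ^ (2 * r + 2) * ((r + 1) * (2 * r + 3) * s ^ 2 + s * (1 - s)) * c ^ 2, ?_⟩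
    linear_combination he - h - 2 * c ^ (2 * r + 1) * (1 + (2 * r + 2) * s * p * c +
        ((r + 1) * (2 * r + 3) * s ^ 2 + s * (1 - s)) * p ^ 2 * c ^ 2) * hc

theorem linearSum_one (r : ℕ) :
    linearSum (padicInv p) r (p - 1) 1 = completeSum (padicInv p) (r + 1) (p - 1) := by
  refine Finset.sum_congr rfl fun k hk => ?_
  rw [risingQuot_one (mul_padicInv_of_le (p := p)) k (Finset.mem_Icc.1 hk).2, one_mul]

theorem natCast_pred_add_one : (p : ℤ_[p]) - (p - 1 : ℕ) = 1 := by
  rw [Nat.cast_sub hp.out.one_le]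
  simp

/-- The power sum of the reciprocals modulo `p ^ 2`, in terms of a double sum. -/
theorem powerSum_congr_weightedSum {r : ℕ} (hr : r + 2 < p - 1) :
    (p : ℤ_[p]) ^ 2 ∣ (r + 2) * powerSum (padicInv p) (r + 1) (p - 1) -
      (r + 1) * (p * weightedSum (padicInv p) (padicInv p) 2 r (p - 1)) := by
  have h := linearSum_congr (p := p) (r := r) (a := p - 1) (by omega) (by omega) 1
  rw [one_mul, natCast_pred_add_one, linearSum_one] at h
  obtain ⟨e, he⟩ := h
  obtain ⟨f, hf⟩ := dvd_powerSum (p := p) (t := r + 2) (by omega) hr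
  obtain ⟨g, hg⟩ := sq_dvd_completeSum_sub_powerSum (p := p) (u := 1) le_rfl (r := r + 1)
    (by omega) (by omega)
  simp only [pow_one, one_mul] at hg
  push_cast at hg
  refine ⟨(r + 1) * e - g - (r + 1) * (r + 2) * f, ?_⟩
  linear_combination (r + 1) * he - hg - (r + 1) * (r + 2) * p * hf

theorem quadraticSum_one_sub {R : Type*} [CommRing R] (c : ℕ → R) (r n : ℕ) (x : R) :
    quadraticSum c r n (1 - x) = quadraticSum c r n x := by
  simp only [quadraticSum, sub_sub_cancel]
  exact Finset.sum_congr rfl fun k _ => by ring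

theorem padicInv_reflect_pow {j : ℕ} (h1 : 1 ≤ j) (h2 : j < p) (r : ℕ) :
    ∃ e, padicInv p (p - j) ^ (2 * r + 1) = -padicInv p j ^ (2 * r + 1) *
      (1 + (2 * r + 1) * p * padicInv p j +
        (2 * r + 1) * (r + 1) * p ^ 2 * padicInv p j ^ 2) + p ^ 3 * e := by
  have h := padicInv_reflect h1 h2
  generalize padicInv p (p - j) = d at *
  generalize padicInv p j = c at *
  have hd : d = -c * (1 + p * c + p ^ 2 * c ^ 2) + p ^ 3 * (c ^ 3 * d) := by
    linear_combination (1 + p * c + p ^ 2 * c ^ 2) * h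
  generalize c ^ 3 * d = t at *
  induction r with
  | zero => exact ⟨t, by push_cast; linear_combination hd⟩
  | succ r ih =>
    obtain ⟨e, he⟩ := ih
    rw [show 2 * (r + 1) + 1 = 2 * r + 1 + 2 by ring, pow_add, he]
    set u := -c * (1 + p * c + p ^ 2 * c ^ 2) with hu
    have h2 : d ^ 2 = c ^ 2 * (1 + 2 * p * c + 3 * p ^ 2 * c ^ 2) +
        p ^ 3 * (c ^ 2 * (2 * c ^ 3 + p * c ^ 4) + 2 * u * t + p ^ 3 * t ^ 2) := by
      rw [hd, hu]
      ring
    rw [h2]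
    generalize c ^ 2 * (2 * c ^ 3 + p * c ^ 4) + 2 * u * t + p ^ 3 * t ^ 2 = v
    generalize hM : (2 * r + 1 : ℤ_[p]) = M
    refine ⟨e * (c ^ 2 * (1 + 2 * p * c + 3 * p ^ 2 * c ^ 2) + p ^ 3 * v) -
      c ^ (2 * r + 1) * (1 + M * p * c + M * (r + 1) * p ^ 2 * c ^ 2) * v -
      c ^ (2 * r + 1) * c ^ 2 * (3 * M * c ^ 3 + 2 * M * (r + 1) * c ^ 3 +
        3 * M * (r + 1) * p * c ^ 4), ?_⟩
    push_cast
    rw [← hM]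
    ring

theorem two_mul_powerSum (t : ℕ) :
    2 * powerSum (padicInv p) t (p - 1) =
      ∑ j ∈ Finset.Icc 1 (p - 1), (padicInv p j ^ t + padicInv p (p - j) ^ t) := by
  rw [Finset.sum_add_distrib, two_mul, powerSum]
  congr 1
  rw [sum_Icc_one, sum_Icc_one, ← Finset.sum_range_reflect]
  refine Finset.sum_congr rfl fun k hk => ?_
  rw [Finset.mem_range] at hk
  congr 2
  omega

theorem powerSum_odd_congr {r : ℕ} (hr : 2 * r + 3 < p) :
    (p : ℤ_[p]) ^ 3 ∣ 2 * powerSum (padicInv p) (2 * r + 1) (p - 1) +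
      (2 * r + 1) * p * powerSum (padicInv p) (2 * r + 2) (p - 1) := by
  have hodd := hp.out.eq_two_or_odd
  obtain ⟨f, hf⟩ := dvd_powerSum (p := p) (t := 2 * r + 3) (by omega) (by omega)
  have h : (p : ℤ_[p]) ^ 3 ∣ 2 * powerSum (padicInv p) (2 * r + 1) (p - 1) +
      ((2 * r + 1) * p * powerSum (padicInv p) (2 * r + 2) (p - 1) +
        (2 * r + 1) * (r + 1) * p ^ 2 * powerSum (padicInv p) (2 * r + 3) (p - 1)) := by
    rw [two_mul_powerSum, powerSum, powerSum, Finset.mul_sum, Finset.mul_sum,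
      ← Finset.sum_add_distrib, ← Finset.sum_add_distrib]
    refine Finset.dvd_sum fun j hj => ?_
    rw [Finset.mem_Icc] at hj
    obtain ⟨e, he⟩ := padicInv_reflect_pow (p := p) (j := j) hj.1 (by omega) r
    exact ⟨e, by linear_combination he⟩
  obtain ⟨e, he⟩ := h
  exact ⟨e - (2 * r + 1) * (r + 1) * f, by
    linear_combination he - (2 * r + 1) * (r + 1) * p ^ 2 * hf⟩

/-- The relation between the sums occurring in `quadraticSum_prime_mul`. -/
theorem completeSum_sub_weightedSum {r : ℕ} (hr : 2 * r + 3 < p) :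
    (p : ℤ_[p]) ^ 3 ∣ p * completeSum (fun j => padicInv p j ^ 2) (r + 1) (p - 1) -
      p ^ 2 * weightedSum (padicInv p) (fun j => padicInv p j ^ 2) 3 r (p - 1) -
      (2 * r + 1) * p * powerSum (padicInv p) (2 * r + 2) (p - 1) := by
  obtain ⟨e₀, h₀⟩ := quadraticSum_congr (p := p) (r := r) (a := p - 1) (by omega) (by omega) 0
  obtain ⟨e₁, h₁⟩ := quadraticSum_prime_mul (p := p) r 1
  obtain ⟨e₃, h₃⟩ := powerSum_odd_congr hr
  have h₄ : (0 * p - (p - 1 : ℕ) : ℤ_[p]) = 1 - 1 * p := by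
    linear_combination natCast_pred_add_one (p := p)
  rw [h₄, quadraticSum_one_sub] at h₀
  exact ⟨e₀ - e₁ - e₃, by linear_combination h₀ - h₁ - h₃⟩

end PadicSums

section PadicBernoulli

variable {p : ℕ} [hp : Fact p.Prime]

theorem norm_bernoulli_le_one {m : ℕ} (hm : m < p - 1) :
    ‖((bernoulli m : ℚ) : ℚ_[p])‖ ≤ 1 := by
  induction m using Nat.strong_induction_on with
  | _ m ih =>
    have h := congrArg (fun q : ℚ => (q : ℚ_[p])) (sum_bernoulli (m + 1))
    rw [Finset.sum_range_succ, Nat.choose_succ_self_right] at h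
    push_cast at h
    have hsum : ‖∑ k ∈ Finset.range m, ((m + 1).choose k : ℚ_[p]) * (bernoulli k : ℚ_[p])‖ ≤ 1 := by
      refine IsUltrametricDist.norm_sum_le_of_forall_le_of_nonneg zero_le_one fun k hk => ?_
      rw [Finset.mem_range] at hk
      rw [norm_mul]
      exact mul_le_one₀ (IsUltrametricDist.norm_natCast_le_one ℚ_[p] _) (norm_nonneg _) (ih k hk (by omega))
    have hunit : ‖((m : ℚ_[p]) + 1)‖ = 1 := by
      have := PadicInt.isUnit_iff.1 (isUnit_natCast_padicInt (p := p) (j := m + 1) (by omega)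
        (by omega))
      rw [PadicInt.norm_def] at this
      simpa using this
    have hrhs : ‖(((if m + 1 = 1 then 1 else 0 : ℚ)) : ℚ_[p])‖ ≤ 1 := by
      split_ifs <;> simp
    have h' : ((m : ℚ_[p]) + 1) * (bernoulli m : ℚ_[p]) =
        ((if m + 1 = 1 then 1 else 0 : ℚ) : ℚ_[p]) -
          ∑ k ∈ Finset.range m, ((m + 1).choose k : ℚ_[p]) * (bernoulli k : ℚ_[p]) := by
      push_cast
      linear_combination h
    have h'' := congrArg norm h'
    rw [norm_mul, hunit, one_mul] at h''
    rw [h'', sub_eq_add_neg]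
    refine (IsUltrametricDist.norm_add_le_max _ _).trans (max_le hrhs ?_)
    rwa [norm_neg]

open Classical in
/-- The Bernoulli number `B_m` as a `p`-adic integer, with junk value `0` if it is not one. -/
noncomputable def padicBernoulli (p : ℕ) [Fact p.Prime] (m : ℕ) : ℤ_[p] :=
  if h : ∃ b : ℤ_[p], (b : ℚ_[p]) = ((bernoulli m : ℚ) : ℚ_[p]) then h.choose else 0

theorem coe_padicBernoulli {m : ℕ} (hm : m < p - 1) :
    (padicBernoulli p m : ℚ_[p]) = ((bernoulli m : ℚ) : ℚ_[p]) := by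
  have h : ∃ b : ℤ_[p], (b : ℚ_[p]) = ((bernoulli m : ℚ) : ℚ_[p]) :=
    ⟨⟨_, norm_bernoulli_le_one hm⟩, rfl⟩
  rw [padicBernoulli, dif_pos h]
  exact h.choose_spec

/-- Faulhaber's formula over `ℤ_[p]`. -/
theorem faulhaber_padicInt {n : ℕ} (hn : n < p - 1) (a : ℕ) :
    ((n : ℤ_[p]) + 1) * ∑ j ∈ Finset.Icc 1 a, (j : ℤ_[p]) ^ n =
      ∑ i ∈ Finset.range (n + 1),
        (-1) ^ i * padicBernoulli p i * ((n + 1).choose i) * (a : ℤ_[p]) ^ (n + 1 - i) := by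
  have h := sum_Ico_pow a n
  rw [← Finset.sum_div, eq_div_iff (by positivity)] at h
  have hI : Finset.Ico 1 (a + 1) = Finset.Icc 1 a := by
    ext
    simp
  rw [hI] at h
  replace h := congrArg (fun q : ℚ => (q : ℚ_[p])) h
  apply PadicInt.ext
  push_cast [PadicInt.coe_sum] at h ⊢
  rw [mul_comm, h]
  refine Finset.sum_congr rfl fun i hi => ?_
  rw [Finset.mem_range] at hi
  rw [coe_padicBernoulli (by omega), bernoulli'_eq_bernoulli]
  push_cast
  ring

theorem sum_pow_toZMod {m t a : ℕ} (h : m + t = p - 1) (ha : a < p) :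
    PadicInt.toZMod (powerSum (padicInv p) t a) =
      PadicInt.toZMod (∑ j ∈ Finset.Icc 1 a, (j : ℤ_[p]) ^ m) := by
  rw [powerSum_toZMod _ _ ha, map_sum]
  refine Finset.sum_congr rfl fun j hj => ?_
  rw [Finset.mem_Icc] at hj
  have h0 := natCast_zmod_ne_zero (p := p) hj.1 (by omega)
  have h1 := ZMod.pow_card_sub_one_eq_one h0
  rw [← h, pow_add] at h1
  rw [map_pow, map_natCast, inv_pow]
  exact (eq_inv_of_mul_eq_one_left h1).symm

open Polynomial in
/-- The polynomial `B_n(X)` over `ℤ_[p]`, for `n < p - 1`. -/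
noncomputable def padicBernoulliPoly (p : ℕ) [Fact p.Prime] (n : ℕ) : ℤ_[p][X] :=
  ∑ i ∈ Finset.range (n + 1), C (padicBernoulli p i * (n.choose i)) * X ^ (n - i)

theorem coe_eval_padicBernoulliPoly {n : ℕ} (hn : n < p - 1) (x : ℤ_[p]) :
    (((padicBernoulliPoly p n).eval x : ℤ_[p]) : ℚ_[p]) =
      Polynomial.aeval (x : ℚ_[p]) (Polynomial.bernoulli n) := by
  rw [padicBernoulliPoly, Polynomial.bernoulli, Polynomial.eval_finsetSum, map_sum]
  push_cast [PadicInt.coe_sum]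
  refine Finset.sum_congr rfl fun i hi => ?_
  rw [Finset.mem_range] at hi
  rw [Polynomial.aeval_monomial]
  simp [coe_padicBernoulli (p := p) (m := i) (by omega)]

theorem eval_neg_padicBernoulliPoly {n : ℕ} (hn : n + 1 < p - 1) (h1 : 1 ≤ n) (a : ℕ) :
    (padicBernoulliPoly p (n + 1)).eval (-a : ℤ_[p]) =
      (-1) ^ (n + 1) * (padicBernoulli p (n + 1) +
        (n + 1) * ∑ j ∈ Finset.Icc 1 a, (j : ℤ_[p]) ^ n) := by
  apply PadicInt.ext
  have e : (-a : ℚ_[p]) = algebraMap ℚ ℚ_[p] (-a : ℚ) := by simp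
  have h := Polynomial.sum_range_pow_eq_bernoulli_sub (a + 1) n
  have h2 : (Polynomial.bernoulli (n + 1)).eval ((a + 1 : ℕ) : ℚ) =
      (-1) ^ (n + 1) * (Polynomial.bernoulli (n + 1)).eval (-a : ℚ) := by
    rw [← Polynomial.bernoulli_eval_one_sub]
    push_cast
    congr 1
    ring
  have h3 : ∑ k ∈ Finset.range (a + 1), (k : ℚ) ^ n = ∑ j ∈ Finset.Icc 1 a, (j : ℚ) ^ n := by
    rw [Finset.sum_range_succ', sum_Icc_one]
    simp [show n ≠ 0 by omega]
  have h4 : (Polynomial.bernoulli (n + 1)).eval (-a : ℚ) = (-1) ^ (n + 1) *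
      (bernoulli (n + 1) + (n + 1) * ∑ j ∈ Finset.Icc 1 a, (j : ℚ) ^ n) := by
    rw [h3, h2] at h
    have hs : ((-1 : ℚ) ^ (n + 1)) * (-1) ^ (n + 1) = 1 := by
      rw [← mul_pow]
      simp
    linear_combination (-(-1) ^ (n + 1)) * h - (Polynomial.bernoulli (n + 1)).eval (-a : ℚ) * hs
  have h5 := coe_eval_padicBernoulliPoly hn (-a : ℤ_[p])
  rw [h5]
  push_cast
  rw [e, Polynomial.aeval_algebraMap_apply_eq_algebraMap_eval, h4, coe_padicBernoulli hn,
    eq_ratCast]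
  push_cast [PadicInt.coe_sum]
  rfl

/-- Harmonic sums modulo `p` in terms of Bernoulli polynomials. -/
theorem powerSum_congr_bernoulli {t a : ℕ} (h1 : 2 ≤ t) (h2 : t + 1 < p) (ha : a < p)
    {x s : ℤ_[p]} (hx : x = s * p - a) :
    (p : ℤ_[p]) ∣ t * powerSum (padicInv p) t a -
      (padicBernoulli p (p - t) - (-1) ^ (p - t) * (padicBernoulliPoly p (p - t)).eval x) := by
  obtain ⟨n, hn⟩ : ∃ n, p - t = n + 1 := ⟨p - t - 1, by omega⟩
  rw [hn]
  have hpt : (n : ℤ_[p]) + 1 = p - t := by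
    rw [eq_sub_iff_add_eq]
    exact_mod_cast (show n + 1 + t = p by omega)
  obtain ⟨e, he⟩ : (p : ℤ_[p]) ∣ powerSum (padicInv p) t a -
      ∑ j ∈ Finset.Icc 1 a, (j : ℤ_[p]) ^ n := by
    rw [prime_dvd_iff_toZMod, map_sub, sum_pow_toZMod (m := n) (by omega) ha, sub_self]
  obtain ⟨f, hf⟩ : (p : ℤ_[p]) ∣ (padicBernoulliPoly p (n + 1)).eval x -
      (padicBernoulliPoly p (n + 1)).eval (-a : ℤ_[p]) :=
    dvd_trans ⟨s, by rw [hx]; ring⟩ (Polynomial.sub_dvd_eval_sub x (-a) _)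
  rw [eval_neg_padicBernoulliPoly (by omega) (by omega), hpt] at hf
  have hs : ((-1 : ℤ_[p]) ^ (n + 1)) * (-1) ^ (n + 1) = 1 := by
    rw [← mul_pow]
    simp
  generalize ((-1 : ℤ_[p]) ^ (n + 1)) = σ at *
  generalize ∑ j ∈ Finset.Icc 1 a, (j : ℤ_[p]) ^ n = S at *
  refine ⟨t * e + σ * f + S, ?_⟩
  linear_combination t * he + σ * hf + (padicBernoulli p (n + 1) + (p - t) * S) * hs

open Polynomial in
theorem natDegree_risingQuot_le {K : Type*} [Field K] (d : ℕ → K) (k : ℕ) :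
    (risingQuot (fun j => C (d j)) X k).natDegree ≤ k := by
  induction k with
  | zero => simp [risingQuot_zero]
  | succ k ih =>
    rw [risingQuot_succ]
    refine natDegree_mul_le_of_le ih ?_
    rw [← C_eq_natCast]
    compute_degree

open Polynomial in
theorem C_completeSum {K : Type*} [Field K] (d : ℕ → K) (r k : ℕ) :
    completeSum (fun j => C (d j)) r k = C (completeSum d r k) :=
  (map_completeSum C d r k).symm

open Polynomial in
theorem natDegree_linearSum_le {K : Type*} [Field K] (d : ℕ → K) (r n : ℕ) :
    (linearSum (fun j => C (d j)) r n X).natDegree ≤ n := by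
  refine natDegree_sum_le_of_forall_le _ _ fun k hk => ?_
  rw [Finset.mem_Icc] at hk
  rw [C_completeSum, ← C_mul]
  exact (natDegree_mul_C_le _ _).trans ((natDegree_risingQuot_le d k).trans hk.2)

open Polynomial in
theorem coeff_one_linearSum {K : Type*} [Field K] (d : ℕ → K) (r n : ℕ)
    (hd : ∀ j, 1 ≤ j → j ≤ n → (j : K) * d j = 1) :
    (linearSum (fun j => C (d j)) r n X).coeff 1 = weightedSum d d 2 r n := by
  rw [linearSum, weightedSum, finsetSum_coeff, sum_Icc_one, sum_Icc_one]
  refine Finset.sum_congr rfl fun k hk => ?_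
  rw [Finset.mem_range] at hk
  rw [C_completeSum, ← C_mul, coeff_mul_C, risingQuot_succ', coeff_mul_C, coeff_X_mul,
    coeff_zero_eq_eval_zero, ← coe_evalRingHom, map_risingQuot]
  simp only [coe_evalRingHom, eval_C, eval_add, eval_X, eval_one, zero_add]
  rw [risingQuot_one hd k hk.le]
  ring

open Polynomial in
/-- The double sum with weights `1` and `2` modulo `p` is a Bernoulli number. -/
theorem weightedSum_congr_bernoulli {r : ℕ} (hr : r + 3 < p) :
    (p : ℤ_[p]) ∣ weightedSum (padicInv p) (padicInv p) 2 r (p - 1) -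
      padicBernoulli p (p - r - 2) := by
  obtain ⟨n, hn⟩ : ∃ n, p - r - 2 = n := ⟨_, rfl⟩
  rw [hn]
  set d : ℕ → ZMod p := fun j => PadicInt.toZMod (padicInv p j) with hd
  set b : ℕ → ZMod p := fun i => (-1) ^ i * PadicInt.toZMod (padicBernoulli p i) with hb
  set f : (ZMod p)[X] := linearSum (fun j => C (d j)) r (p - 1) X with hf
  set G : (ZMod p)[X] := ∑ i ∈ Finset.range (n + 1),
    C (b i * ((n + 1).choose i) * (-1) ^ (n + 1 - i)) * X ^ (n + 1 - i) with hG
  have heval : ∀ a < p, (C ((n : ZMod p) + 1) * f + G).eval (-a : ZMod p) = 0 := by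
    intro a ha
    have h1 : f.eval (-a : ZMod p) = -PadicInt.toZMod (powerSum (padicInv p) (r + 1) a) := by
      have h := (dvd_pow_self (p : ℤ_[p]) two_ne_zero).trans
        (linearSum_congr (p := p) (r := r) (a := a) (by omega) ha 0)
      rw [prime_dvd_iff_toZMod] at h
      simp only [zero_mul, mul_zero, zero_sub, sub_zero, sub_neg_eq_add] at h
      rw [map_add, map_linearSum, map_neg, map_natCast] at h
      rw [hf, ← coe_evalRingHom, map_linearSum]
      simp only [coe_evalRingHom, eval_C, eval_X]
      exact eq_neg_of_add_eq_zero_left h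
    have h2 : G.eval (-a : ZMod p) =
        ((n : ZMod p) + 1) * PadicInt.toZMod (powerSum (padicInv p) (r + 1) a) := by
      have h := congrArg (PadicInt.toZMod (p := p)) (faulhaber_padicInt (p := p) (n := n)
        (by omega) a)
      rw [map_mul, ← sum_pow_toZMod (t := r + 1) (by omega) ha, map_add, map_natCast, map_one,
        map_sum] at h
      rw [h, hG, eval_finsetSum]
      refine Finset.sum_congr rfl fun i _ => ?_
      have hs : ((-1 : ZMod p) ^ (n + 1 - i)) * (-a) ^ (n + 1 - i) = a ^ (n + 1 - i) := by
        rw [← mul_pow]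
        simp
      rw [eval_mul, eval_C, eval_pow, eval_X, hb]
      simp only [map_mul, map_pow, map_neg, map_one, map_natCast]
      rw [mul_assoc, hs]
    rw [eval_add, eval_mul, eval_C, h1, h2]
    ring
  have hzero : C ((n : ZMod p) + 1) * f + G = 0 := by
    refine eq_zero_of_natDegree_lt_card_of_eval_eq_zero _ (f := fun y : ZMod p => y)
      Function.injective_id (fun y => ?_) ?_
    · have := heval (-y).val (ZMod.val_lt _)
      simpa using this
    · rw [ZMod.card]
      refine lt_of_le_of_lt (b := p - 1) ?_ (by omega)
      refine natDegree_add_le_of_degree_le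
        ((natDegree_C_mul_le _ _).trans (natDegree_linearSum_le d r (p - 1))) ?_
      refine natDegree_sum_le_of_forall_le _ _ fun i _ => ?_
      exact (natDegree_C_mul_X_pow_le _ _).trans (by omega)
  have hcoeff := congrArg (fun P => P.coeff 1) hzero
  simp only [coeff_add, coeff_C_mul, coeff_zero] at hcoeff
  rw [hf, coeff_one_linearSum d r (p - 1)] at hcoeff
  · have hG1 : G.coeff 1 = -(b n * ((n : ZMod p) + 1)) := by
      rw [hG, finsetSum_coeff, Finset.sum_eq_single n]
      · simp
      · intro i hi hne
        rw [Finset.mem_range] at hi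
        rw [coeff_C_mul_X_pow, if_neg (by omega)]
      · simp
    rw [hG1] at hcoeff
    have hne : ((n : ZMod p) + 1) ≠ 0 := by
      have := natCast_zmod_ne_zero (p := p) (j := n + 1) (by omega) (by omega)
      exact_mod_cast this
    have hbn : b n = PadicInt.toZMod (padicBernoulli p n) := by
      have h1 := bernoulli'_eq_bernoulli n
      rw [← bernoulli_eq_bernoulli'_of_ne_one (by omega)] at h1
      have h2 : padicBernoulli p n = (-1) ^ n * padicBernoulli p n := by
        apply PadicInt.ext
        push_cast
        rw [coe_padicBernoulli (by omega)]
        exact_mod_cast congrArg (fun q : ℚ => (q : ℚ_[p])) h1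
      conv_rhs => rw [h2]
      simp [hb]
    rw [prime_dvd_iff_toZMod, map_sub, ← hbn]
    have hw : PadicInt.toZMod (weightedSum (padicInv p) (padicInv p) 2 r (p - 1)) =
        weightedSum d d 2 r (p - 1) := by
      simp [weightedSum, map_completeSum, hd]
    rw [hw]
    refine (mul_eq_zero.1 (?_ : ((n : ZMod p) + 1) * _ = 0)).resolve_left hne
    linear_combination hcoeff
  · intro j hj1 hj2
    have := congrArg (PadicInt.toZMod (p := p)) (mul_padicInv_of_le j hj1 hj2)
    simpa using this

end PadicBernoulli

section Translation

theorem monotone_snoc_iff {r : ℕ} (j : Fin r → ℕ) (k : ℕ) :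
    Monotone (Fin.snoc (α := fun _ => ℕ) j k) ↔ Monotone j ∧ ∀ i, j i ≤ k := by
  constructor
  · intro h
    refine ⟨fun a b hab => ?_, fun i => ?_⟩
    · simpa using h (Fin.castSucc_le_castSucc_iff.2 hab)
    · simpa using h (Fin.le_last i.castSucc)
  · rintro ⟨h1, h2⟩ a b hab
    induction b using Fin.lastCases with
    | last =>
      induction a using Fin.lastCases with
      | last => exact le_rfl
      | cast a => simpa using h2 a
    | cast b =>
      induction a using Fin.lastCases with
      | last => exact absurd hab (not_le.2 (Fin.castSucc_lt_last b))
      | cast a => simpa using h1 (Fin.castSucc_le_castSucc_iff.1 hab)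

theorem multHarmonicSum_succ (t r n : ℕ) :
    multHarmonicSum n (fun _ : Fin (r + 1) => t) =
      ∑ k ∈ Finset.Icc 1 n, ((k : ℚ)⁻¹) ^ t * multHarmonicSum k (fun _ : Fin r => t) := by
  classical
  simp only [multHarmonicSum, Finset.mul_sum]
  rw [Finset.sum_sigma']
  refine Finset.sum_bij' (fun j _ => ⟨j (Fin.last r), Fin.init j⟩)
    (fun q _ => Fin.snoc (α := fun _ => ℕ) q.2 q.1) ?_ ?_ ?_ ?_ ?_
  · intro j hj
    rw [Finset.mem_filter, Fintype.mem_piFinset] at hj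
    simp only [Finset.mem_sigma, Finset.mem_filter, Fintype.mem_piFinset]
    refine ⟨hj.1 _, fun i => ?_, ?_⟩
    · exact Finset.mem_Icc.2 ⟨(Finset.mem_Icc.1 (hj.1 _)).1, hj.2 (Fin.le_last _)⟩
    · exact fun a b hab => hj.2 (Fin.castSucc_le_castSucc_iff.2 hab)
  · intro q hq
    simp only [Finset.mem_sigma, Finset.mem_filter, Fintype.mem_piFinset, Finset.mem_Icc] at hq
    rw [Finset.mem_filter, Fintype.mem_piFinset, monotone_snoc_iff]
    refine ⟨fun i => ?_, hq.2.2, fun i => (hq.2.1 i).2⟩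
    rw [Finset.mem_Icc]
    induction i using Fin.lastCases with
    | last => simpa using hq.1
    | cast i => simpa using ⟨(hq.2.1 i).1, (hq.2.1 i).2.trans hq.1.2⟩
  · intro j _
    simp
  · intro q _
    simp
  · intro j _
    rw [Fin.prod_univ_castSucc]
    simp [Fin.init, mul_comm]

theorem multHarmonicSum_eq_completeSum (t r n : ℕ) :
    multHarmonicSum n (fun _ : Fin r => t) = completeSum (fun j => ((j : ℚ)⁻¹) ^ t) r n := by
  induction r generalizing n with
  | zero =>
    classical
    simp only [multHarmonicSum, completeSum_zero]
    rw [Finset.filter_true_of_mem fun j _ => Subsingleton.monotone j]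
    simp
  | succ r ih => simp only [multHarmonicSum_succ, completeSum_succ, ih]

variable {p : ℕ} [hp : Fact p.Prime]

theorem coe_padicInv {j : ℕ} (h1 : 1 ≤ j) (h2 : j < p) :
    (padicInv p j : ℚ_[p]) = (j : ℚ_[p])⁻¹ := by
  have h := congrArg (fun z : ℤ_[p] => (z : ℚ_[p])) (mul_padicInv h1 h2)
  push_cast at h
  exact eq_inv_of_mul_eq_one_right h

theorem coe_completeSum (t r : ℕ) {n : ℕ} (hn : n < p) :
    ((completeSum (fun j => padicInv p j ^ t) r n : ℤ_[p]) : ℚ_[p]) =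
      (multHarmonicSum n (fun _ : Fin r => t) : ℚ_[p]) := by
  rw [multHarmonicSum_eq_completeSum]
  refine (map_completeSum (PadicInt.Coe.ringHom (p := p)) _ r n).trans
    (Eq.trans ?_ (map_completeSum (Rat.castHom ℚ_[p]) _ r n).symm)
  refine completeSum_congr r n fun j h1 h2 => ?_
  have h : PadicInt.Coe.ringHom (padicInv p j) = (j : ℚ_[p])⁻¹ := coe_padicInv h1 (by omega)
  simp [h]

theorem coe_powerSum (t : ℕ) {n : ℕ} (hn : n < p) :
    ((powerSum (padicInv p) t n : ℤ_[p]) : ℚ_[p]) = (harmonicOrder t n : ℚ_[p]) := by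
  rw [powerSum, harmonicOrder, PadicInt.coe_sum]
  push_cast
  refine Finset.sum_congr rfl fun j hj => ?_
  rw [Finset.mem_Icc] at hj
  rw [coe_padicInv hj.1 (by omega), inv_pow, one_div]

theorem coe_risingQuot (x : ℤ_[p]) {k : ℕ} (hk : k < p) :
    ((risingQuot (padicInv p) x k : ℤ_[p]) : ℚ_[p]) =
      pochhammerSymbol (x : ℚ_[p]) k / pochhammerSymbol (1 : ℚ_[p]) k := by
  simp only [pochhammerSymbol]
  induction k with
  | zero => simp [risingQuot_zero]
  | succ k ih =>
    rw [risingQuot_succ, ascPochhammer_succ_eval, ascPochhammer_succ_eval]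
    push_cast
    rw [ih (by omega), coe_padicInv (by omega) hk, mul_div_mul_comm, div_eq_mul_inv (_ + _)]
    push_cast
    rw [add_comm (k : ℚ_[p]) 1]

theorem coe_linearSum (r : ℕ) (x : ℤ_[p]) :
    ((linearSum (padicInv p) r (p - 1) x : ℤ_[p]) : ℚ_[p]) = ∑ k ∈ Finset.Icc 1 (p - 1),
      pochhammerSymbol (x : ℚ_[p]) k / pochhammerSymbol (1 : ℚ_[p]) k *
        ((multHarmonicSum k (fun _ : Fin r => 1) : ℚ_[p]) / (k : ℚ_[p])) := by
  rw [linearSum, PadicInt.coe_sum]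
  refine Finset.sum_congr rfl fun k hk => ?_
  rw [Finset.mem_Icc] at hk
  have h := coe_completeSum (p := p) 1 r (n := k) (by omega)
  simp only [pow_one] at h
  push_cast
  rw [h, coe_risingQuot x (by omega), coe_padicInv hk.1 (by omega)]
  ring

theorem coe_quadraticSum (r : ℕ) (x : ℤ_[p]) :
    ((quadraticSum (padicInv p) r (p - 1) x : ℤ_[p]) : ℚ_[p]) = ∑ k ∈ Finset.Icc 1 (p - 1),
      pochhammerSymbol (x : ℚ_[p]) k * pochhammerSymbol (1 - (x : ℚ_[p])) k /
          pochhammerSymbol (1 : ℚ_[p]) k ^ 2 *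
        ((multHarmonicSum k (fun _ : Fin r => 2) : ℚ_[p]) / (k : ℚ_[p])) := by
  rw [quadraticSum, PadicInt.coe_sum]
  refine Finset.sum_congr rfl fun k hk => ?_
  rw [Finset.mem_Icc] at hk
  push_cast
  rw [coe_completeSum 2 r (by omega), coe_risingQuot x (by omega),
    coe_risingQuot (1 - x) (by omega), coe_padicInv hk.1 (by omega)]
  push_cast
  ring

theorem PadicCongr.of_dvd {m : ℕ} {a b : ℤ_[p]} (h : (p : ℤ_[p]) ^ m ∣ a - b) :
    PadicCongr p m (a : ℚ_[p]) (b : ℚ_[p]) := by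
  obtain ⟨c, hc⟩ := h
  refine ⟨c, ?_⟩
  have := congrArg (fun z : ℤ_[p] => (z : ℚ_[p])) hc
  push_cast at this
  exact this

theorem neg_one_pow_prime_sub {t : ℕ} (h : t < p) (hp2 : p ≠ 2) :
    (-1 : ℤ_[p]) ^ (p - t) = -(-1) ^ t := by
  have hodd : Odd p := hp.out.odd_of_ne_two hp2
  have h1 : (-1 : ℤ_[p]) ^ (p - t) * (-1) ^ t = -1 := by
    rw [← pow_add, Nat.sub_add_cancel h.le, hodd.neg_one_pow]
  have h2 : ((-1 : ℤ_[p]) ^ t) * (-1) ^ t = 1 := by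
    rw [← mul_pow]
    simp
  linear_combination (-1 : ℤ_[p]) ^ t * h1 - (-1 : ℤ_[p]) ^ (p - t) * h2

theorem linearSum_congr_bernoulli {r a : ℕ} (hr : r + 3 < p) (ha : a < p) {x s : ℤ_[p]}
    (hx : x = s * p - a) :
    (p : ℤ_[p]) ^ 2 ∣ linearSum (padicInv p) r (p - 1) x -
      (-powerSum (padicInv p) (r + 1) a -
        (-1) ^ r * s * p * (padicBernoulliPoly p (p - r - 2)).eval x) := by
  obtain ⟨e, he⟩ := linearSum_congr (p := p) (r := r) (by omega) ha s
  obtain ⟨f, hf⟩ := weightedSum_congr_bernoulli hr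
  obtain ⟨g, hg⟩ := powerSum_congr_bernoulli (t := r + 2) (by omega) (by omega) ha hx
  rw [neg_one_pow_prime_sub (by omega) (by omega), pow_add,
    show p - (r + 2) = p - r - 2 by omega] at hg
  rw [← hx] at he
  push_cast at hg
  exact ⟨e + s * f - s * g, by linear_combination he + s * p * hf - s * p * hg⟩

theorem quadraticSum_congr_bernoulli {r a : ℕ} (hr : 2 * r + 3 < p) (ha : a < p) {x s : ℤ_[p]}
    (hx : x = s * p - a) :
    (p : ℤ_[p]) ^ 3 ∣ quadraticSum (padicInv p) r (p - 1) x -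
      (-2 * powerSum (padicInv p) (2 * r + 1) a -
        2 * (2 * r + 1) * s * p * powerSum (padicInv p) (2 * r + 2) a +
        2 * s * (1 + 3 * s * r + 2 * s * r ^ 2) * padicInv p (2 * r + 3) * p ^ 2 *
          (padicBernoulliPoly p (p - 2 * r - 3)).eval x) := by
  have hodd := hp.out.eq_two_or_odd
  obtain ⟨e, he⟩ := quadraticSum_congr (p := p) (r := r) (by omega) ha s
  obtain ⟨f, hf⟩ := completeSum_sub_weightedSum hr
  obtain ⟨g, hg⟩ := sq_dvd_completeSum_sub_powerSum (p := p) (u := 2) (by omega) (r := r + 1)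
    (by omega) (by omega)
  obtain ⟨h, hh⟩ := powerSum_congr_weightedSum (p := p) (r := 2 * r + 1) (by omega)
  obtain ⟨k, hk⟩ := weightedSum_congr_bernoulli (p := p) (r := 2 * r + 1) (by omega)
  obtain ⟨l, hl⟩ := powerSum_congr_bernoulli (t := 2 * r + 3) (by omega) (by omega) ha hx
  have hv := mul_padicInv (p := p) (j := 2 * r + 3) (by omega) hr
  have hsign : (-1 : ℤ_[p]) ^ (p - (2 * r + 3)) = 1 := by
    rw [neg_one_pow_prime_sub hr (by omega), pow_add, pow_mul]
    norm_num
  rw [hsign, show p - (2 * r + 3) = p - 2 * r - 3 by omega] at hl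
  rw [show p - (2 * r + 1) - 2 = p - 2 * r - 3 by omega] at hk
  rw [← hx] at he
  rw [show 2 * (r + 1) = 2 * r + 2 by ring] at hg
  rw [show 2 * r + 1 + 1 = 2 * r + 2 by ring] at hh
  refine dvd_of_natCast_mul (k := r + 1) (by omega) (by omega)
    (dvd_of_natCast_mul (k := 2 * r + 3) (by omega) hr ?_)
  push_cast at hg hh hl hv ⊢
  generalize hκ : (1 + 3 * s * r + 2 * s * r ^ 2 : ℤ_[p]) = κ at he ⊢
  refine ⟨(r + 1) * (2 * r + 3) * e + (2 * r + 3) * ((s - s ^ 2) * g + (r + 1) * s ^ 2 * f) +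
    s * κ * ((2 * r + 2) * k + h) - 2 * (r + 1) * s * κ * l, ?_⟩
  linear_combination (r + 1) * (2 * r + 3) * he + (2 * r + 3) * (r + 1) * s ^ 2 * hf +
    (2 * r + 3) * (s - s ^ 2) * p * hg + s * p * κ * hh + s * p * κ * (2 * r + 2) * p * hk -
    2 * (r + 1) * s * κ * p ^ 2 * hl -
    (r + 1) * 2 * s * κ * p ^ 2 * (padicBernoulliPoly p (p - 2 * r - 3)).eval x * hv +
    (2 * r + 3) * s * p * powerSum (padicInv p) (2 * r + 2) (p - 1) * hκ

end Translation

theorem theorem1 (p : ℕ) [Fact p.Prime] (x : ℤ_[p]) (r : ℕ) (a : ℕ) (s : ℚ_[p])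
    (ha : a = PadicInt.zmodRepr (-x)) (hs : s = ((x : ℚ_[p]) + (a : ℚ_[p])) / (p : ℚ_[p])) :
    (r + 3 < p →
      PadicCongr p 2
        (∑ k ∈ Finset.Icc 1 (p - 1),
          pochhammerSymbol (x : ℚ_[p]) k / pochhammerSymbol (1 : ℚ_[p]) k *
            ((multHarmonicSum k (fun _ : Fin r => 1) : ℚ_[p]) / (k : ℚ_[p])))
        (-(harmonicOrder (r + 1) a : ℚ_[p])
          - (-1) ^ r * s * (p : ℚ_[p]) *
              Polynomial.aeval (x : ℚ_[p]) (Polynomial.bernoulli (p - r - 2)))) ∧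
    (2 * r + 3 < p →
      PadicCongr p 3
        (∑ k ∈ Finset.Icc 1 (p - 1),
          pochhammerSymbol (x : ℚ_[p]) k * pochhammerSymbol (1 - (x : ℚ_[p])) k /
              pochhammerSymbol (1 : ℚ_[p]) k ^ 2 *
            ((multHarmonicSum k (fun _ : Fin r => 2) : ℚ_[p]) / (k : ℚ_[p])))
        (-2 * (harmonicOrder (2 * r + 1) a : ℚ_[p])
          - 2 * (2 * (r : ℚ_[p]) + 1) * s * (p : ℚ_[p]) * (harmonicOrder (2 * r + 2) a : ℚ_[p])
          + 2 * s * (1 + 3 * s * (r : ℚ_[p]) + 2 * s * (r : ℚ_[p]) ^ 2) / (2 * (r : ℚ_[p]) + 3) *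
              (p : ℚ_[p]) ^ 2 *
              Polynomial.aeval (x : ℚ_[p]) (Polynomial.bernoulli (p - 2 * r - 3)))) := by
  have hlt : a < p := ha ▸ PadicInt.zmodRepr_lt_p (-x)
  obtain ⟨u, hu⟩ : (p : ℤ_[p]) ∣ -x - a := by
    have := PadicInt.sub_zmodRepr_mem (-x)
    rwa [PadicInt.maximalIdeal_eq_span_p, Ideal.mem_span_singleton, ← ha] at this
  have hx : x = -u * p - a := by linear_combination -hu
  have hp0 : (p : ℚ_[p]) ≠ 0 := by exact_mod_cast (Fact.out : p.Prime).ne_zero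
  have hs' : s = ((-u : ℤ_[p]) : ℚ_[p]) := by
    rw [hs, div_eq_iff hp0, hx]
    push_cast
    ring
  refine ⟨fun hr => ?_, fun hr => ?_⟩
  · have h := PadicCongr.of_dvd (linearSum_congr_bernoulli hr hlt hx)
    rw [coe_linearSum] at h
    convert h using 1
    push_cast
    rw [coe_powerSum _ hlt, coe_eval_padicBernoulliPoly (by omega), hs']
    push_cast
    rfl
  · have h := PadicCongr.of_dvd (quadraticSum_congr_bernoulli hr hlt hx)
    rw [coe_quadraticSum] at h
    convert h using 1
    have h3 := coe_padicInv (p := p) (j := 2 * r + 3) (by omega) hr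
    push_cast at h3 ⊢
    rw [coe_powerSum _ hlt, coe_powerSum _ hlt, coe_eval_padicBernoulliPoly (by omega), h3, hs']
    push_cast
    rfl
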